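/- Let $\kappa\ge 0$ be an integer, $d=2\kappa+3$ and $\lambda=(d-2)/2=\kappa+\tfrac12$. Put $[f,g]_\lambda=\int_{-1}^1 f(x)g(x)(1-x^2)^{\lambda-1/2}\,dx$, let $$C_n^\lambda(x)=\frac{\Gamma(n+2\lambda)}{n!\,\Gamma(2\lambda)}\;{}_2F_1\!\left(-n,\,n+2\lambda;\,\lambda+\tfrac12;\,\tfrac{1-x}{2}\right)$$ be the Gegenbauer polynomials, $W_n^\lambda=C_n^\lambda/C_n^\lambda(1)$, and $N_{d,n}=\binom{n+d-1}{n}-\binom{n+d-3}{n-2}$ (the second binomial coefficient being $0$ for $n<2$). The thinplate spline function $k_{d,1}$ is defined by the series $$k_{d,1}\sim\sum_{n=1}^\infty \frac{N_{d,n}}{n(n+d-2)}\,W_n^\lambda,$$ understood as an orthogonal expansion: $k_{d,1}$ is integrable on $[-1,1]$ with respect to the weight $(1-x^2)^{\lambda-1/2}$, and $[k_{d,1},W_n^\lambda]_\lambda/[W_n^\lambda,W_n^\lambda]_\lambda$ equals $\frac{N_{d,n}}{n(n+d-2)}$ for $n\ge1$ and $0$ for $n=0$. This determines $k_{d,1}$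 up to equality almost everywhere, and $k_{d,1}$ denotes the representative that is continuous on $[-1,1)$. Define $$g_\nu^\lambda=\begin{cases}\dfrac{-1}{2\kappa+1},&\nu=0,\\[2mm] \dfrac{1}{2\kappa+1},&\nu=1,\\[2mm] 2^\nu\dbinom{\kappa}{\nu}\dfrac{(\nu-1)!\,(2\kappa-\nu)!}{(2\kappa+1)!},&1<\nu\le\kappa.\end{cases}$$ Then such a function exists, it is unique, and for all $x\in[-1,1)$ $$k_{d,1}(x)=\frac{-1}{2\kappa+1}\ln\!\left(\frac{1-x}{2}\right)+\sum_{\nu=1}^{\kappa}g_\nu^\lambda(1-x)^{-\nu}-D_\lambda .$$ More precisely, a function $f$ on $[-1,1]$ has the above expansion if and only if it agrees almost everywhere with the right-hand side, and in that case it agrees with the right-hand side at every point of $[-1,1)$ if it is continuous on $[-1,1)$. Here $$D_\lambda=\frac{1}{f_\kappa}\left(\sum_{\nu=1}^{\kappa}g_\nu^\lambda\,G_\lambda^\nu(1)+\frac{2^{2\kappa+1}(-1)^\kappa}{2\kappa+1}\sum_{\nu=0}^{\kappa}\binom{\kappa}{\nu}\frac{(-1)^\nu}{(2\kappa-\nu+1)^2}\right),\qquad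 f_\kappa=\frac{\sqrt{\pi}\,\Gamma(\kappa+1)}{\Gamma(\kappa+\frac32)},$$ where $$G_\lambda^\nu(1)=\int_{-1}^1(1-x^2)^\kappa(1-x)^{-\nu}\,dx=\frac{2^{2\kappa-\nu+1}\,\kappa!\,(\kappa-\nu)!}{(2\kappa-\nu+1)!}\qquad(0\le\nu\le\kappa).$$ Moreover $D_\lambda=[S_\lambda,e_0]_\lambda/[e_0,e_0]_\lambda$, where $e_0=1$ and $S_\lambda(x)=g_0^\lambda\ln\frac{1-x}{2}+\sum_{\nu=1}^{\kappa}g_\nu^\lambda(1-x)^{-\nu}$. -/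

import Mathlib

open MeasureTheory Set
open scoped Nat

namespace Thinplate

noncomputable section

/-- The inner product `[f, g]_lam`, the integral of `f * g` over `[-1, 1]` with the weight
`(1 - x ^ 2) ^ (lam - 1 / 2)`. -/
def gegInner (lam : ℝ) (f g : ℝ → ℝ) : ℝ :=
  ∫ x in (-1 : ℝ)..1, f x * g x * (1 - x ^ 2) ^ (lam - 1 / 2)

/-- The Gegenbauer polynomial `C_n^lam`, as a terminating hypergeometric function
(used for `lam > 0`). -/
def gegenbauerC (lam : ℝ) (n : ℕ) (x : ℝ) : ℝ :=
  Real.Gamma (n + 2 * lam) / (n ! * Real.Gamma (2 * lam)) *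
    ordinaryHypergeometric (-(n : ℝ)) (n + 2 * lam) (lam + 1 / 2) ((1 - x) / 2)

/-- The Gegenbauer polynomial `W_n^lam`, normalized to take the value `1` at `1`. -/
def gegenbauerW (lam : ℝ) (n : ℕ) (x : ℝ) : ℝ :=
  gegenbauerC lam n x / gegenbauerC lam n 1

/-- The dimension of the space of spherical harmonics of degree `n` on the unit sphere of
`d`-dimensional space, `d ≥ 2`. The second binomial coefficient is zero when its lower entry
`n - 2` is negative. -/
def harmonicDim (d n : ℕ) : ℝ :=
  ((n + d - 1).choose n : ℝ) - (if n < 2 then 0 else ((n + d - 3).choose (n - 2) : ℝ))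

/-- `f` belongs to the weighted space `L^1` on `[-1, 1]` and has the orthogonal expansion
`f ~ ∑ n, b n * W_n^lam`: for every `n`, the Fourier-Gegenbauer coefficient of `f` with respect to
`W_n^lam` is `b n`. -/
structure HasGegenbauerExpansion (lam : ℝ) (f : ℝ → ℝ) (b : ℕ → ℝ) : Prop where
  integrable : IntegrableOn (fun x => f x * (1 - x ^ 2) ^ (lam - 1 / 2)) (Icc (-1) 1)
  coeff_eq : ∀ n : ℕ,
    gegInner lam f (gegenbauerW lam n) / gegInner lam (gegenbauerW lam n) (gegenbauerW lam n) = b n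

/-- `f` is given by the series `∑ n ≥ 1, [n (n + d - 2)] ^ (-m) * N_{d,n} * W_n^lam`,
`lam = (d - 2) / 2`, which is the series of the thinplate spline function `k_{d,m}`. The series is
understood as an orthogonal expansion. -/
def HasThinplateSeries (d m : ℕ) (f : ℝ → ℝ) : Prop :=
  HasGegenbauerExpansion (((d : ℝ) - 2) / 2) f fun n =>
    if n = 0 then 0 else (((n : ℝ) * ((n : ℝ) + (d : ℝ) - 2)) ^ m)⁻¹ * harmonicDim d n

/-- The coefficients `g_ν^lam`, `lam = κ + 1 / 2`, used for `0 ≤ ν ≤ κ`. -/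
def gCoeff (κ ν : ℕ) : ℝ :=
  if ν = 0 then -1 / (2 * κ + 1)
  else if ν = 1 then 1 / (2 * κ + 1)
  else 2 ^ ν * (κ.choose ν : ℝ) * ((ν - 1)! * (2 * κ - ν)!) / (2 * κ + 1)!

/-- The Beta integral of `(1 - y ^ 2) ^ μ` over `[-1, 1]`, in closed form. -/
def betaConst (μ : ℝ) : ℝ :=
  √Real.pi * Real.Gamma (μ + 1) / Real.Gamma (μ + 3 / 2)

/-- The integral of `(1 - z ^ 2) ^ κ * (1 - z) ^ (-ν)` over `[-1, 1]`, in closed form,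
for `0 ≤ ν ≤ κ`. -/
def GConst (κ ν : ℕ) : ℝ :=
  2 ^ (2 * κ - ν + 1) * (κ ! * (κ - ν)!) / (2 * κ - ν + 1)!

/-- The constant `D_lam`, `lam = κ + 1 / 2`. -/
def DConst (κ : ℕ) : ℝ :=
  1 / betaConst κ *
    (∑ ν ∈ Finset.Icc 1 κ, gCoeff κ ν * GConst κ ν +
      1 / (2 * κ + 1) * 2 ^ (2 * κ + 1) * (-1) ^ κ *
        ∑ ν ∈ Finset.range (κ + 1), (κ.choose ν : ℝ) * (-1) ^ ν / (2 * (κ : ℝ) - ν + 1) ^ 2)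

/-- The function `S_lam`, `lam = κ + 1 / 2`: the closed form without its additive constant. -/
def SFun (κ : ℕ) (x : ℝ) : ℝ :=
  -1 / (2 * κ + 1) * Real.log ((1 - x) / 2) +
    ∑ ν ∈ Finset.Icc 1 κ, gCoeff κ ν * ((1 - x) ^ ν)⁻¹

end

end Thinplate

namespace Thinplate

noncomputable section

open Polynomial

/-! ### Gegenbauer polynomials of half-integer parameter -/

/-! Since `lam - 1 / 2 = κ`, the weight is the polynomial w = (1 - x²)^κ, and d - 2 = 2κ + 1. Write
W_n for `gegPoly κ n` and S for `SFun κ`. The hypergeometric equation takes the Sturm–Liouville form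
((1 - x²)^(κ+1) W_n')' = -n(n + 2κ + 1) w W_n, which gives orthogonality. The closed form is a
Green's function of this operator with its pole at 1: the g_ν are exactly those for which (1 -
x²)^(κ+1) S' = F, where F is the primitive of w vanishing at -1 (`hasDerivAt_weightPrim`,
`weight_mul_deriv_SFun`).

For n ≥ 1, integrating by parts twice leaves only the boundary term F(1) W_n(1) = ∫ w, so n(n + 2κ +
1) ∫ S W_n w = ∫ w (`integral_SFun_mul_gegPoly`). The three-term recurrence gives ‖W_n‖² N_{d,n} = ∫
w (`weightInt_sq_mul_harmonicDim`), and the quotient is the required coefficient. Subtracting the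
weighted mean `DConst κ` of S removes the coefficient at n = 0 and affects no other.

Uniqueness: the W_n span all polynomials (`span_gegPoly`), and by Weierstrass approximation an
integrable function on a compact interval whose polynomial moments all vanish is zero almost
everywhere. -/

/-- The coefficients of `₂F₁(-n, n + 2κ + 1; κ + 1; t)`. -/
def gegCoeff (κ n k : ℕ) : ℝ :=
  ordinaryHypergeometricCoefficient (-(n : ℝ)) (n + 2 * κ + 1) (κ + 1) k

lemma ascPochhammer_eval_succ_left (x : ℝ) (k : ℕ) :
    (ascPochhammer ℝ (k + 1)).eval x = x * (ascPochhammer ℝ k).eval (x + 1) := by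
  simp [ascPochhammer_succ_left, eval_comp]

lemma ascPochhammer_eval_natCast_add_one_ne_zero (κ k : ℕ) :
    (ascPochhammer ℝ k).eval ((κ : ℝ) + 1) ≠ 0 :=
  (ascPochhammer_pos k _ (by positivity)).ne'

lemma gegCoeff_zero (κ n : ℕ) : gegCoeff κ n 0 = 1 := by
  simp [gegCoeff, ordinaryHypergeometricCoefficient]

lemma gegCoeff_eq_zero {κ n k : ℕ} (h : n < k) : gegCoeff κ n k = 0 := by
  have : (ascPochhammer ℝ k).eval (-(n : ℝ)) = 0 :=
    (ascPochhammer_eval_eq_zero_iff _ _).2 ⟨n, h, by simp⟩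
  simp [gegCoeff, ordinaryHypergeometricCoefficient, this]

lemma gegCoeff_succ (κ n k : ℕ) :
    (k + 1) * (k + κ + 1) * gegCoeff κ n (k + 1) =
      (k - n) * (k + n + 2 * κ + 1) * gegCoeff κ n k := by
  have h := ascPochhammer_eval_natCast_add_one_ne_zero κ k
  have h1 : (κ : ℝ) + 1 + k ≠ 0 := by positivity
  have h2 : (k ! : ℝ) ≠ 0 := by positivity
  simp only [gegCoeff, ordinaryHypergeometricCoefficient, ascPochhammer_succ_eval,
    Nat.factorial_succ, Nat.cast_mul, Nat.cast_add, Nat.cast_one]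
  field_simp
  ring

lemma gegCoeff_recurrence (κ n k : ℕ) :
    (n + 2 * κ + 2) * gegCoeff κ (n + 2) (k + 1) =
      (2 * n + 2 * κ + 3) * (gegCoeff κ (n + 1) (k + 1) - 2 * gegCoeff κ (n + 1) k) -
        (n + 1) * gegCoeff κ n (k + 1) := by
  have h := ascPochhammer_eval_natCast_add_one_ne_zero κ k
  have h1 : (κ : ℝ) + 1 + k ≠ 0 := by positivity
  have h2 : (k ! : ℝ) ≠ 0 := by positivity
  have h3 : (k : ℝ) + 1 ≠ 0 := by positivity
  -- The Pochhammer symbols of the three neighbouring degrees overlap in k factors. All of them are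
  -- reduced to A and B, after which a polynomial identity remains.
  set A := (ascPochhammer ℝ k).eval (-((n : ℝ) + 1)) with hA
  set B := (ascPochhammer ℝ k).eval ((n : ℝ) + 1 + 2 * κ + 1) with hB
  have a2 : (ascPochhammer ℝ (k + 1)).eval (-((n : ℝ) + 2)) = -((n : ℝ) + 2) * A := by
    rw [ascPochhammer_eval_succ_left, hA]; congr 2; ring
  have a1 : (ascPochhammer ℝ (k + 1)).eval (-((n : ℝ) + 1)) = A * (-((n : ℝ) + 1) + k) := by
    rw [ascPochhammer_succ_eval]
  have a0 : ((n : ℝ) + 1) * (ascPochhammer ℝ (k + 1)).eval (-(n : ℝ)) =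
      -(A * (-((n : ℝ) + 1) + k) * (-((n : ℝ) + 1) + (k + 1))) := by
    have := ascPochhammer_eval_succ_left (-((n : ℝ) + 1)) (k + 1)
    rw [ascPochhammer_succ_eval, ascPochhammer_succ_eval, ← hA,
      show -((n : ℝ) + 1) + 1 = -n by ring] at this
    push_cast at this
    linarith
  have b2 : ((n : ℝ) + 2 * κ + 2) *
      (ascPochhammer ℝ (k + 1)).eval ((n : ℝ) + 2 + 2 * κ + 1) =
      B * ((n : ℝ) + 1 + 2 * κ + 1 + k) * ((n : ℝ) + 1 + 2 * κ + 1 + (k + 1)) := by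
    have := ascPochhammer_eval_succ_left ((n : ℝ) + 1 + 2 * κ + 1) (k + 1)
    rw [ascPochhammer_succ_eval, ascPochhammer_succ_eval, ← hB,
      show (n : ℝ) + 1 + 2 * κ + 1 + 1 = n + 2 + 2 * κ + 1 by ring] at this
    push_cast at this
    linarith
  have b1 : (ascPochhammer ℝ (k + 1)).eval ((n : ℝ) + 1 + 2 * κ + 1) =
      B * ((n : ℝ) + 1 + 2 * κ + 1 + k) := by
    rw [ascPochhammer_succ_eval]
  have b0 : (ascPochhammer ℝ (k + 1)).eval ((n : ℝ) + 2 * κ + 1) =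
      ((n : ℝ) + 2 * κ + 1) * B := by
    rw [ascPochhammer_eval_succ_left, hB]; congr 2; ring
  simp only [gegCoeff, ordinaryHypergeometricCoefficient, Nat.factorial_succ, Nat.cast_mul,
    Nat.cast_add, Nat.cast_one, Nat.cast_ofNat]
  rw [a2, a1, b1, b0, ← hA, ← hB, ascPochhammer_succ_eval k ((κ : ℝ) + 1)]
  set C := (ascPochhammer ℝ k).eval ((κ : ℝ) + 1)
  set D := (ascPochhammer ℝ (k + 1)).eval (-(n : ℝ))
  set E := (ascPochhammer ℝ (k + 1)).eval ((n : ℝ) + 2 + 2 * κ + 1)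
  field_simp
  linear_combination (-((n : ℝ) + 2) * A) * b2 + ((n : ℝ) + 2 * κ + 1) * B * a0

/-- The polynomial `₂F₁(-n, n + 2κ + 1; κ + 1; t)` in the variable `t`. -/
def hyperPoly (κ n : ℕ) : ℝ[X] :=
  ∑ k ∈ Finset.range (n + 1), monomial k (gegCoeff κ n k)

lemma coeff_hyperPoly (κ n k : ℕ) : (hyperPoly κ n).coeff k = gegCoeff κ n k := by
  simp only [hyperPoly, finsetSum_coeff, coeff_monomial, Finset.sum_ite_eq', Finset.mem_range]
  split_ifs with h
  · rfl
  · exact (gegCoeff_eq_zero (by omega)).symm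

/-- Comparing coefficients of X^k turns the hypergeometric equation into the two-term recursion
`gegCoeff_succ`. -/
lemma hyperPoly_ode (κ n : ℕ) :
    (X - X ^ 2) * derivative (derivative (hyperPoly κ n)) +
      C ((κ : ℝ) + 1) * (1 - 2 * X) * derivative (hyperPoly κ n) +
      C ((n : ℝ) * (n + 2 * κ + 1)) * hyperPoly κ n = 0 := by
  ext k
  have e (p : ℝ[X]) : (X - X ^ 2) * derivative (derivative p) +
      C ((κ : ℝ) + 1) * (1 - 2 * X) * derivative p + C ((n : ℝ) * (n + 2 * κ + 1)) * p =
      derivative (derivative p) * X - derivative (derivative p) * X ^ 2 +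
      C ((κ : ℝ) + 1) * derivative p - C (2 * ((κ : ℝ) + 1)) * (derivative p * X) +
      C ((n : ℝ) * (n + 2 * κ + 1)) * p := by
    have h2 : (C (2 * ((κ : ℝ) + 1)) : ℝ[X]) = 2 * C ((κ : ℝ) + 1) := by rw [C_mul, C_ofNat]
    rw [h2]; ring
  rw [e]
  have h0 := gegCoeff_succ κ n k
  rcases k with _ | _ | k
  · simp [coeff_derivative, coeff_hyperPoly] at h0 ⊢
    linear_combination h0
  · simp only [coeff_add, coeff_sub, coeff_mul_X, coeff_mul_X_pow', coeff_C_mul, coeff_derivative,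
      coeff_hyperPoly, coeff_zero]
    norm_num at h0 ⊢
    linear_combination h0
  · simp only [coeff_add, coeff_sub, coeff_mul_X, coeff_mul_X_pow, coeff_C_mul, coeff_derivative,
      coeff_hyperPoly, coeff_zero]
    push_cast at h0 ⊢
    linear_combination h0

/-- The three-term recurrence before substitution: under t = (1 - x)/2 the factor 1 - 2t becomes x.
-/
lemma hyperPoly_recurrence (κ n : ℕ) :
    C ((n : ℝ) + 2 * κ + 2) * hyperPoly κ (n + 2) =
      C (2 * (n : ℝ) + 2 * κ + 3) * ((1 - 2 * X) * hyperPoly κ (n + 1)) -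
        C ((n : ℝ) + 1) * hyperPoly κ n := by
  have e : (1 - 2 * X) * hyperPoly κ (n + 1) =
      hyperPoly κ (n + 1) - C 2 * (hyperPoly κ (n + 1) * X) := by
    rw [C_ofNat]; ring
  rw [e]
  ext k
  rcases k with _ | k
  · simp [coeff_hyperPoly, gegCoeff_zero]
    ring
  · simp only [coeff_sub, coeff_C_mul, coeff_mul_X, coeff_hyperPoly]
    exact gegCoeff_recurrence κ n k

/-- The polynomial `W_n^lam`, `lam = κ + 1 / 2`. -/
def gegPoly (κ n : ℕ) : ℝ[X] := (hyperPoly κ n).comp (C (1 / 2) * (1 - X))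

lemma gegPoly_zero (κ : ℕ) : gegPoly κ 0 = 1 := by
  simp [gegPoly, hyperPoly, gegCoeff_zero]

lemma gegPoly_one (κ : ℕ) : gegPoly κ 1 = X := by
  have h := gegCoeff_succ κ 1 0
  have h2 : gegCoeff κ 1 1 = -2 := by
    have : (κ : ℝ) + 1 ≠ 0 := by positivity
    rw [gegCoeff_zero] at h
    push_cast at h
    apply mul_left_cancel₀ this
    linear_combination h
  have e : hyperPoly κ 1 = 1 - C 2 * X := by
    simp [hyperPoly, Finset.sum_range_succ, gegCoeff_zero, h2, ← C_mul_X_eq_monomial,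
      sub_eq_add_neg]
  rw [gegPoly, e]
  simp only [sub_comp, one_comp, mul_comp, C_comp, X_comp]
  rw [← mul_assoc, ← C_mul]
  norm_num

lemma gegPoly_ode (κ n : ℕ) :
    (1 - X ^ 2) * derivative (derivative (gegPoly κ n)) -
      C (2 * (κ : ℝ) + 2) * X * derivative (gegPoly κ n) +
      C ((n : ℝ) * (n + 2 * κ + 1)) * gegPoly κ n = 0 := by
  have h := congrArg (fun p => p.comp (C (1 / 2) * (1 - X))) (hyperPoly_ode κ n)
  have e : derivative (C (1 / 2) * (1 - X) : ℝ[X]) = C (-(1 / 2)) := by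
    simp
  simp only [add_comp, mul_comp, sub_comp, pow_comp, X_comp, C_comp, one_comp, zero_comp] at h
  simp only [gegPoly, derivative_comp, e, derivative_mul, derivative_C, zero_mul, zero_add]
  apply Polynomial.funext
  intro x
  have h' := congrArg (eval x) h
  simp at h' ⊢
  linear_combination h'

lemma gegPoly_recurrence (κ n : ℕ) :
    C ((n : ℝ) + 2 * κ + 2) * gegPoly κ (n + 2) =
      C (2 * (n : ℝ) + 2 * κ + 3) * (X * gegPoly κ (n + 1)) -
        C ((n : ℝ) + 1) * gegPoly κ n := by
  have h := congrArg (fun p => p.comp (C (1 / 2) * (1 - X))) (hyperPoly_recurrence κ n)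
  simp only [mul_comp, sub_comp, X_comp, C_comp, one_comp] at h
  apply Polynomial.funext
  intro x
  have h' := congrArg (eval x) h
  simp [gegPoly] at h' ⊢
  linear_combination h'

/-- The recurrence, solved for X W_{n+1}, shows that the span is stable under multiplication by X;
it also contains 1 = W_0. -/
lemma span_gegPoly (κ : ℕ) : Submodule.span ℝ (range (gegPoly κ)) = ⊤ := by
  set M := Submodule.span ℝ (range (gegPoly κ)) with hM
  have mem (n) : gegPoly κ n ∈ M := Submodule.subset_span ⟨n, rfl⟩
  have hX : ∀ p ∈ M, X * p ∈ M := by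
    intro p hp
    induction hp using Submodule.span_induction with
    | mem p hp =>
      obtain ⟨n, rfl⟩ := hp
      rcases n with _ | n
      · rw [gegPoly_zero, mul_one, ← gegPoly_one κ]
        exact mem 1
      · have hne : 2 * (n : ℝ) + 2 * κ + 3 ≠ 0 := by positivity
        have : X * gegPoly κ (n + 1) = (2 * (n : ℝ) + 2 * κ + 3)⁻¹ •
            (((n : ℝ) + 2 * κ + 2) • gegPoly κ (n + 2) + ((n : ℝ) + 1) • gegPoly κ n) := by
          rw [eq_inv_smul_iff₀ hne]
          simp only [smul_eq_C_mul]
          linear_combination -gegPoly_recurrence κ n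
        rw [this]
        exact M.smul_mem _ (M.add_mem (M.smul_mem _ (mem _)) (M.smul_mem _ (mem _)))
    | zero => simp
    | add p q _ _ hp hq => rw [mul_add]; exact M.add_mem hp hq
    | smul a p _ hp => rw [mul_smul_comm]; exact M.smul_mem _ hp
  have hpow (n : ℕ) : (X ^ n : ℝ[X]) ∈ M := by
    induction n with
    | zero => rw [pow_zero, ← gegPoly_zero κ]; exact mem 0
    | succ n ih => rw [pow_succ']; exact hX _ ih
  rw [eq_top_iff]
  intro p _
  induction p using Polynomial.induction_on' with
  | add p q hp hq => exact M.add_mem (hp trivial) (hq trivial)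
  | monomial n a => rw [← C_mul_X_pow_eq_monomial, ← smul_eq_C_mul]; exact M.smul_mem _ (hpow n)

/-- The hypergeometric function is 1 at argument 0, so normalizing cancels the nonzero Gamma
prefactor. The series stops at k = n. -/
lemma gegenbauerW_eq {lam : ℝ} {κ : ℕ} (hl : lam = κ + 1 / 2) (n : ℕ) (x : ℝ) :
    gegenbauerW lam n x = (gegPoly κ n).eval x := by
  have h2 : 2 * lam = 2 * κ + 1 := by rw [hl]; ring
  have hG : Real.Gamma (n + 2 * lam) / (n ! * Real.Gamma (2 * lam)) ≠ 0 := by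
    have h1 : 0 < Real.Gamma (n + 2 * lam) := Real.Gamma_pos_of_pos (by rw [h2]; positivity)
    have h3 : 0 < Real.Gamma (2 * lam) := Real.Gamma_pos_of_pos (by rw [h2]; positivity)
    positivity
  rw [gegenbauerW, gegenbauerC, gegenbauerC, sub_self, zero_div, ordinaryHypergeometric_zero,
    mul_one, mul_div_cancel_left₀ _ hG, ordinaryHypergeometric_eq_tsum]
  have hc : lam + 1 / 2 = (κ : ℝ) + 1 := by rw [hl]; ring
  have hb : (n : ℝ) + 2 * lam = n + 2 * κ + 1 := by rw [h2]; ring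
  simp only [hb, hc]
  rw [tsum_eq_sum (s := Finset.range (n + 1))]
  · simp only [gegPoly, hyperPoly, eval_comp, eval_finsetSum, eval_monomial]
    refine Finset.sum_congr rfl fun k _ => ?_
    rw [smul_eq_mul, gegCoeff]
    congr 2
    simp
    ring
  · intro k hk
    have := gegCoeff_eq_zero (κ := κ) (n := n) (k := k) (by simpa using hk)
    rw [gegCoeff, ordinaryHypergeometricCoefficient] at this
    rw [this, zero_smul]

/-! ### Orthogonality and norms -/

/-- The integral of a polynomial over `[-1, 1]` with the weight `(1 - x ^ 2) ^ κ`. -/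
def weightInt (κ : ℕ) : ℝ[X] →ₗ[ℝ] ℝ where
  toFun p := ∫ x in (-1 : ℝ)..1, p.eval x * (1 - x ^ 2) ^ κ
  map_add' p q := by
    simp only [eval_add, add_mul]
    exact intervalIntegral.integral_add (Continuous.intervalIntegrable (by fun_prop) _ _)
      (Continuous.intervalIntegrable (by fun_prop) _ _)
  map_smul' a p := by
    simp only [eval_smul, smul_eq_mul, mul_assoc, RingHom.id_apply]
    exact intervalIntegral.integral_const_mul _ _

lemma weightInt_apply (κ : ℕ) (p : ℝ[X]) :
    weightInt κ p = ∫ x in (-1 : ℝ)..1, p.eval x * (1 - x ^ 2) ^ κ := rfl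

lemma weightInt_C_mul (κ : ℕ) (a : ℝ) (p : ℝ[X]) : weightInt κ (C a * p) = a * weightInt κ p := by
  rw [← smul_eq_C_mul, map_smul, smul_eq_mul]

lemma gegPoly_eval_one (κ n : ℕ) : (gegPoly κ n).eval 1 = 1 := by
  simp [gegPoly, eval_comp, ← coeff_zero_eq_eval_zero, coeff_hyperPoly, gegCoeff_zero]

lemma gegPoly_ode_eval (κ n : ℕ) (x : ℝ) :
    (1 - x ^ 2) * (derivative (derivative (gegPoly κ n))).eval x -
      (2 * κ + 2) * x * (derivative (gegPoly κ n)).eval x +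
      n * (n + 2 * κ + 1) * (gegPoly κ n).eval x = 0 := by
  have h := congrArg (eval x) (gegPoly_ode κ n)
  simp at h
  linear_combination h

lemma hasDerivAt_weight_mul_derivative (κ n : ℕ) (x : ℝ) :
    HasDerivAt (fun x => (1 - x ^ 2) ^ (κ + 1) * (derivative (gegPoly κ n)).eval x)
      (-(n * (n + 2 * κ + 1)) * ((gegPoly κ n).eval x * (1 - x ^ 2) ^ κ)) x := by
  have h1 : HasDerivAt (fun x : ℝ => (1 - x ^ 2) ^ (κ + 1))
      ((κ + 1 : ℕ) * (1 - x ^ 2) ^ κ * (-(2 * x))) x := by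
    have := (((hasDerivAt_id x).pow 2).const_sub 1).pow (κ + 1)
    exact this.congr_deriv (by simp)
  refine (h1.mul ((derivative (gegPoly κ n)).hasDerivAt x)).congr_deriv ?_
  push_cast
  linear_combination (1 - x ^ 2) ^ κ * gegPoly_ode_eval κ n x

/-- The weighted Wronskian vanishes at ±1, and its derivative is the difference of eigenvalues times
the integrand. That difference is (n - m)(n + m + 2κ + 1) ≠ 0. -/
lemma weightInt_gegPoly_mul_of_ne {κ m n : ℕ} (h : m ≠ n) :
    weightInt κ (gegPoly κ m * gegPoly κ n) = 0 := by
  have hd (x : ℝ) : HasDerivAt (fun x =>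
      (1 - x ^ 2) ^ (κ + 1) * (derivative (gegPoly κ m)).eval x * (gegPoly κ n).eval x -
      (1 - x ^ 2) ^ (κ + 1) * (derivative (gegPoly κ n)).eval x * (gegPoly κ m).eval x)
      (((n : ℝ) * (n + 2 * κ + 1) - m * (m + 2 * κ + 1)) *
        ((gegPoly κ m * gegPoly κ n).eval x * (1 - x ^ 2) ^ κ)) x := by
    refine (((hasDerivAt_weight_mul_derivative κ m x).mul ((gegPoly κ n).hasDerivAt x)).sub
      ((hasDerivAt_weight_mul_derivative κ n x).mul ((gegPoly κ m).hasDerivAt x))).congr_deriv ?_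
    rw [eval_mul]
    ring
  have hi := intervalIntegral.integral_eq_sub_of_hasDerivAt (a := -1) (b := 1)
    (fun x _ => hd x) (Continuous.intervalIntegrable (by fun_prop) _ _)
  rw [intervalIntegral.integral_const_mul, ← weightInt_apply] at hi
  norm_num at hi
  rcases hi with hi | hi
  · exfalso
    have h2 : ((n : ℝ) - m) * (n + m + 2 * κ + 1) = 0 := by linear_combination hi
    rcases mul_eq_zero.1 h2 with h2 | h2
    · exact h (by exact_mod_cast (sub_eq_zero.1 h2).symm)
    · have : 0 < (n : ℝ) + m + 2 * κ + 1 := by positivity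
      exact this.ne' h2
  · exact hi

lemma weightInt_gegPoly {κ n : ℕ} (h : n ≠ 0) : weightInt κ (gegPoly κ n) = 0 := by
  have := weightInt_gegPoly_mul_of_ne (κ := κ) h
  rwa [gegPoly_zero, mul_one] at this

lemma weightInt_X_mul (κ n : ℕ) :
    (2 * n + 2 * κ + 3) * weightInt κ (X * gegPoly κ (n + 1) * gegPoly κ n) =
      (n + 1) * weightInt κ (gegPoly κ n * gegPoly κ n) := by
  have h : C (2 * (n : ℝ) + 2 * κ + 3) * (X * gegPoly κ (n + 1) * gegPoly κ n) =
      C ((n : ℝ) + 2 * κ + 2) * (gegPoly κ (n + 2) * gegPoly κ n) +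
        C ((n : ℝ) + 1) * (gegPoly κ n * gegPoly κ n) := by
    linear_combination (-gegPoly κ n) * gegPoly_recurrence κ n
  have h := congrArg (weightInt κ) h
  rwa [weightInt_C_mul, map_add (weightInt κ), weightInt_C_mul, weightInt_C_mul,
    weightInt_gegPoly_mul_of_ne (by omega), mul_zero, zero_add] at h

lemma weightInt_X_mul' (κ n : ℕ) :
    (2 * n + 2 * κ + 3) * weightInt κ (X * gegPoly κ (n + 2) * gegPoly κ (n + 1)) =
      (n + 2 * κ + 2) * weightInt κ (gegPoly κ (n + 2) * gegPoly κ (n + 2)) := by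
  have h : C (2 * (n : ℝ) + 2 * κ + 3) * (X * gegPoly κ (n + 2) * gegPoly κ (n + 1)) =
      C ((n : ℝ) + 2 * κ + 2) * (gegPoly κ (n + 2) * gegPoly κ (n + 2)) +
        C ((n : ℝ) + 1) * (gegPoly κ n * gegPoly κ (n + 2)) := by
    linear_combination (-gegPoly κ (n + 2)) * gegPoly_recurrence κ n
  have h := congrArg (weightInt κ) h
  rwa [weightInt_C_mul, map_add (weightInt κ), weightInt_C_mul, weightInt_C_mul,
    weightInt_gegPoly_mul_of_ne (m := n) (by omega), mul_zero, add_zero] at h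

/-- The integral of x W_{n+1} W_n w is evaluated in two ways, by the recurrence applied at two
consecutive indices. For n = 0 the second is not available, but W_1 = x makes the first one suffice.
-/
lemma weightInt_gegPoly_sq_succ (κ n : ℕ) :
    (2 * n + 2 * κ + 3) * (n + 2 * κ + 1) *
        weightInt κ (gegPoly κ (n + 1) * gegPoly κ (n + 1)) =
      (2 * n + 2 * κ + 1) * (n + 1) * weightInt κ (gegPoly κ n * gegPoly κ n) := by
  rcases n with _ | n
  · have h := weightInt_X_mul κ 0
    simp only [zero_add, gegPoly_one, gegPoly_zero, mul_one] at h ⊢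
    push_cast at h ⊢
    linear_combination (2 * (κ : ℝ) + 1) * h
  · have h1 := weightInt_X_mul κ (n + 1)
    have h2 := weightInt_X_mul' κ n
    push_cast at h1 h2 ⊢
    linear_combination (2 * (n : ℝ) + 2 * κ + 3) * h1 - (2 * (n : ℝ) + 2 * κ + 5) * h2

lemma harmonicDim_eq (κ n : ℕ) :
    (2 * κ + 1) * harmonicDim (2 * κ + 3) n = (2 * n + 2 * κ + 1) * ((n + 2 * κ).choose n : ℝ) := by
  rcases n with _ | _ | n
  · simp [harmonicDim]
  · rw [harmonicDim, show 0 + 1 + (2 * κ + 3) - 1 = 2 * κ + 3 by omega,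
      show 0 + 1 + 2 * κ = 2 * κ + 1 by omega]
    norm_num
    ring
  · have e : harmonicDim (2 * κ + 3) (n + 1 + 1) =
        ((n + 2 + 2 * κ + 2).choose (n + 2) : ℝ) - ((n + 2 + 2 * κ).choose n : ℝ) := by
      rw [harmonicDim, if_neg (by omega), show n + 1 + 1 + (2 * κ + 3) - 1 = n + 2 + 2 * κ + 2 by omega,
        show n + 1 + 1 + (2 * κ + 3) - 3 = n + 2 + 2 * κ by omega,
        show n + 1 + 1 - 2 = n by omega]
    -- Pascal's rule applied twice; the subtracted binomial in `harmonicDim` cancels the first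
    -- summand.
    have h1 : (n + 2 + 2 * κ + 2).choose (n + 2) = (n + 2 + 2 * κ).choose n +
        2 * (n + 2 + 2 * κ).choose (n + 1) + (n + 2 + 2 * κ).choose (n + 2) := by
      simp only [Nat.choose_succ_succ]
      ring
    have h2 := Nat.choose_succ_right_eq (n + 2 + 2 * κ) (n + 1)
    rw [show n + 2 + 2 * κ - (n + 1) = 2 * κ + 1 by omega] at h2
    have h2' : ((n + 2 + 2 * κ).choose (n + 2) : ℝ) * (n + 2) =
        (n + 2 + 2 * κ).choose (n + 1) * (2 * κ + 1) := by exact_mod_cast h2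
    rw [e, h1, show n + 1 + 1 = n + 2 by rfl]
    push_cast
    linear_combination (-2) * h2'

lemma harmonicDim_succ (κ n : ℕ) :
    (n + 1) * (2 * n + 2 * κ + 1) * harmonicDim (2 * κ + 3) (n + 1) =
      (2 * n + 2 * κ + 3) * (n + 2 * κ + 1) * harmonicDim (2 * κ + 3) n := by
  have h0 := harmonicDim_eq κ n
  have h1 := harmonicDim_eq κ (n + 1)
  have h2 := Nat.add_one_mul_choose_eq (n + 2 * κ) n
  have h2' : ((n : ℝ) + 2 * κ + 1) * (n + 2 * κ).choose n =
      (n + 1 + 2 * κ).choose (n + 1) * (n + 1) := by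
    rw [show n + 1 + 2 * κ = n + 2 * κ + 1 by ring]
    exact_mod_cast h2
  have hne : 2 * (κ : ℝ) + 1 ≠ 0 := by positivity
  apply mul_left_cancel₀ hne
  push_cast at h1
  linear_combination ((n : ℝ) + 1) * (2 * n + 2 * κ + 1) * h1 -
    (2 * (n : ℝ) + 2 * κ + 3) * (n + 2 * κ + 1) * h0 -
    (2 * (n : ℝ) + 2 * κ + 1) * (2 * n + 2 * κ + 3) * h2'

/-- The step ratios of ‖W_n‖² and of the dimension are reciprocal, so the product does not depend on
n. -/
lemma weightInt_sq_mul_harmonicDim (κ n : ℕ) :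
    weightInt κ (gegPoly κ n * gegPoly κ n) * harmonicDim (2 * κ + 3) n = weightInt κ 1 := by
  induction n with
  | zero => simp [gegPoly_zero, harmonicDim]
  | succ n ih =>
    have h1 := weightInt_gegPoly_sq_succ κ n
    have h2 := harmonicDim_succ κ n
    have hne : ((n : ℝ) + 1) * (2 * n + 2 * κ + 1) *
        ((2 * n + 2 * κ + 3) * (n + 2 * κ + 1)) ≠ 0 := by positivity
    apply mul_left_cancel₀ hne
    rw [← ih]
    linear_combination ((n : ℝ) + 1) * (2 * n + 2 * κ + 1) *
      harmonicDim (2 * κ + 3) (n + 1) * h1 + ((2 * (n : ℝ) + 2 * κ + 1) * (n + 1)) *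
      weightInt κ (gegPoly κ n * gegPoly κ n) * h2

/-! ### Beta and logarithm integrals -/

lemma integral_one_add_pow_mul_one_sub_pow (a b : ℕ) :
    ∫ x in (-1 : ℝ)..1, (1 + x) ^ a * (1 - x) ^ b =
      2 ^ (a + b + 1) * (a ! * b !) / (a + b + 1)! := by
  induction b generalizing a with
  | zero =>
    have hd (x : ℝ) : HasDerivAt (fun x : ℝ => (1 + x) ^ (a + 1) / ((a : ℝ) + 1))
        ((1 + x) ^ a * (1 - x) ^ 0) x := by
      have := ((((hasDerivAt_id x).const_add 1).pow (a + 1)).div_const ((a : ℝ) + 1))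
      refine this.congr_deriv ?_
      have : (a : ℝ) + 1 ≠ 0 := by positivity
      simp
      field_simp
    rw [intervalIntegral.integral_eq_sub_of_hasDerivAt (fun x _ => hd x)
      (Continuous.intervalIntegrable (by fun_prop) _ _)]
    simp [Nat.factorial_succ]
    norm_num
    field_simp
  | succ b ih =>
    have hd (x : ℝ) : HasDerivAt (fun x : ℝ => (1 + x) ^ (a + 1) * (1 - x) ^ (b + 1))
        (((a : ℝ) + 1) * ((1 + x) ^ a * (1 - x) ^ (b + 1)) -
          ((b : ℝ) + 1) * ((1 + x) ^ (a + 1) * (1 - x) ^ b)) x := by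
      have := (((hasDerivAt_id x).const_add 1).pow (a + 1)).mul
        (((hasDerivAt_id x).const_sub 1).pow (b + 1))
      refine this.congr_deriv ?_
      simp
      ring
    have hi := intervalIntegral.integral_eq_sub_of_hasDerivAt (a := -1) (b := 1)
      (fun x _ => hd x) (Continuous.intervalIntegrable (by fun_prop) _ _)
    rw [intervalIntegral.integral_sub (Continuous.intervalIntegrable (by fun_prop) _ _)
      (Continuous.intervalIntegrable (by fun_prop) _ _), intervalIntegral.integral_const_mul,
      intervalIntegral.integral_const_mul, ih] at hi
    have hne : (a : ℝ) + 1 ≠ 0 := by positivity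
    apply mul_left_cancel₀ hne
    have e : a + 1 + b + 1 = a + (b + 1) + 1 := by ring
    rw [e] at hi
    norm_num at hi
    rw [sub_eq_zero] at hi
    rw [hi]
    simp only [Nat.factorial_succ a, Nat.factorial_succ b]
    push_cast
    ring

/-- The point x = 1 must be excluded: with `0⁻¹ = 0`, the identity fails there when ν = κ ≥ 1. The
integrals below therefore use it almost everywhere. -/
lemma one_sub_sq_pow_mul_inv {κ ν : ℕ} (h : ν ≤ κ) {x : ℝ} (hx : x ≠ 1) :
    (1 - x ^ 2) ^ κ * ((1 - x) ^ ν)⁻¹ = (1 + x) ^ κ * (1 - x) ^ (κ - ν) := by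
  have hx' : 1 - x ≠ 0 := sub_ne_zero.2 hx.symm
  rw [show 1 - x ^ 2 = (1 + x) * (1 - x) by ring, mul_pow, mul_assoc, ← pow_sub₀ _ hx' h]

lemma ae_ne_one : ∀ᵐ x : ℝ, x ≠ 1 := by
  simp [ae_iff]

lemma integral_eq_GConst {κ ν : ℕ} (h : ν ≤ κ) :
    ∫ x in (-1 : ℝ)..1, (1 - x ^ 2) ^ κ * ((1 - x) ^ ν)⁻¹ = GConst κ ν := by
  have e : ∫ x in (-1 : ℝ)..1, (1 - x ^ 2) ^ κ * ((1 - x) ^ ν)⁻¹ =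
      ∫ x in (-1 : ℝ)..1, (1 + x) ^ κ * (1 - x) ^ (κ - ν) := by
    refine intervalIntegral.integral_congr_ae ?_
    filter_upwards [ae_ne_one] with x hx _ using one_sub_sq_pow_mul_inv h hx
  rw [e, integral_one_add_pow_mul_one_sub_pow, GConst, show κ + (κ - ν) = 2 * κ - ν by omega]

lemma weightInt_one (κ : ℕ) : weightInt κ 1 = GConst κ 0 := by
  rw [← integral_eq_GConst (Nat.zero_le κ), weightInt_apply]
  simp

lemma weightInt_one_pos (κ : ℕ) : 0 < weightInt κ 1 := by
  rw [weightInt_one, GConst]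
  positivity

lemma betaConst_eq (κ : ℕ) : betaConst κ = GConst κ 0 := by
  induction κ with
  | zero =>
    have : Real.Gamma (3 / 2) = 1 / 2 * √Real.pi := by
      rw [← Real.Gamma_one_half_eq, show (3 / 2 : ℝ) = 1 / 2 + 1 by norm_num,
        Real.Gamma_add_one (by norm_num)]
    have hpi : √Real.pi ≠ 0 := (Real.sqrt_pos.2 Real.pi_pos).ne'
    simp [betaConst, GConst, this]
    field_simp
  | succ κ ih =>
    have h1 : Real.Gamma ((κ : ℝ) + 1 + 1) = (κ + 1) * Real.Gamma (κ + 1) :=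
      Real.Gamma_add_one (by positivity)
    have h2 : Real.Gamma ((κ : ℝ) + 1 + 3 / 2) = (κ + 3 / 2) * Real.Gamma (κ + 3 / 2) := by
      rw [← Real.Gamma_add_one (by positivity)]
      congr 1
      ring
    have e : betaConst ((κ + 1 : ℕ) : ℝ) = (κ + 1) / (κ + 3 / 2) * betaConst κ := by
      rw [betaConst, betaConst]
      push_cast
      rw [h1, h2]
      have : Real.Gamma ((κ : ℝ) + 3 / 2) ≠ 0 := (Real.Gamma_pos_of_pos (by positivity)).ne'
      field_simp
    rw [e, ih, GConst, GConst]
    simp only [Nat.sub_zero, show 2 * (κ + 1) + 1 = 2 * κ + 1 + 1 + 1 by ring,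
      Nat.factorial_succ (2 * κ + 1 + 1), Nat.factorial_succ (2 * κ + 1), Nat.factorial_succ κ]
    push_cast
    field_simp
    ring

lemma intervalIntegrable_mul_log (g : ℝ → ℝ) (hg : Continuous g) (a b : ℝ) :
    IntervalIntegrable (fun t => g t * Real.log t) volume a b :=
  intervalIntegral.intervalIntegrable_log'.continuousOn_mul hg.continuousOn

lemma integral_pow_mul_log (m : ℕ) :
    ∫ t in (0 : ℝ)..1, t ^ m * Real.log t = -1 / ((m : ℝ) + 1) ^ 2 := by
  have hm : (m : ℝ) + 1 ≠ 0 := by positivity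
  -- The primitive is written with t log t, which is continuous at 0, so the fundamental theorem
  -- applies up to the singular endpoint.
  have hc : Continuous (fun t : ℝ => t ^ m * (t * Real.log t) / ((m : ℝ) + 1) -
      t ^ (m + 1) / ((m : ℝ) + 1) ^ 2) :=
    (((continuous_pow m).mul Real.continuous_mul_log).div_const _).sub
      ((continuous_pow (m + 1)).div_const _)
  have hd : ∀ t ∈ Ioo (0 : ℝ) 1, HasDerivAt (fun t : ℝ => t ^ m * (t * Real.log t) /
      ((m : ℝ) + 1) - t ^ (m + 1) / ((m : ℝ) + 1) ^ 2) (t ^ m * Real.log t) t := by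
    intro t ht
    have e : (fun t : ℝ => t ^ m * (t * Real.log t) / ((m : ℝ) + 1) -
      t ^ (m + 1) / ((m : ℝ) + 1) ^ 2) = (fun t : ℝ => t ^ (m + 1) * Real.log t / ((m : ℝ) + 1) -
      t ^ (m + 1) / ((m : ℝ) + 1) ^ 2) := by
      ext t; ring
    rw [e]
    have := (((hasDerivAt_pow (m + 1) t).mul (Real.hasDerivAt_log ht.1.ne')).div_const
      ((m : ℝ) + 1)).sub ((hasDerivAt_pow (m + 1) t).div_const (((m : ℝ) + 1) ^ 2))
    refine this.congr_deriv ?_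
    have ht' := ht.1.ne'
    simp
    field_simp
    ring
  rw [intervalIntegral.integral_eq_sub_of_hasDerivAt_of_le zero_le_one hc.continuousOn hd
    (intervalIntegrable_mul_log _ (continuous_pow m) _ _)]
  simp
  ring

lemma integral_log_mul_weight (κ : ℕ) :
    ∫ x in (-1 : ℝ)..1, Real.log ((1 - x) / 2) * (1 - x ^ 2) ^ κ =
      -(2 ^ (2 * κ + 1) * (-1) ^ κ *
        ∑ ν ∈ Finset.range (κ + 1), (κ.choose ν : ℝ) * (-1) ^ ν / (2 * (κ : ℝ) - ν + 1) ^ 2) := by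
  -- Substitution t = (1 - x)/2, under which 1 - x² = 4t(1 - t). Expanding (1 - t)^κ then leaves
  -- integrals of t^m log t.
  have h := intervalIntegral.integral_comp_sub_div (a := -1) (b := 1)
    (fun t : ℝ => Real.log t * (4 * t * (1 - t)) ^ κ) (c := 2) two_ne_zero (1 / 2)
  have e1 : (fun x : ℝ => Real.log (1 / 2 - x / 2) *
      (4 * (1 / 2 - x / 2) * (1 - (1 / 2 - x / 2))) ^ κ) =
      fun x => Real.log ((1 - x) / 2) * (1 - x ^ 2) ^ κ := by
    ext x
    congr 2 <;> ring
  rw [e1] at h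
  rw [h]
  norm_num
  have e2 : (fun t : ℝ => Real.log t * (4 * t * (1 - t)) ^ κ) = fun t => ∑ ν ∈ Finset.range (κ + 1),
      (4 ^ κ * (-1) ^ κ * ((κ.choose ν : ℝ) * (-1) ^ ν)) * (t ^ (2 * κ - ν) * Real.log t) := by
    ext t
    have hb : (1 - t) ^ κ = ∑ ν ∈ Finset.range (κ + 1), 1 ^ ν * (-t) ^ (κ - ν) * κ.choose ν := by
      rw [← add_pow, sub_eq_add_neg]
    rw [mul_pow, hb, mul_pow, Finset.mul_sum, Finset.mul_sum]
    refine Finset.sum_congr rfl fun ν hν => ?_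
    have hν' : ν ≤ κ := by simpa [Nat.lt_succ_iff] using hν
    rw [show 2 * κ - ν = κ + (κ - ν) by omega, pow_add, neg_pow, one_pow]
    have hs : (-1 : ℝ) ^ (κ - ν) = (-1) ^ κ * (-1) ^ ν := by
      obtain ⟨j, rfl⟩ := Nat.exists_eq_add_of_le hν'
      rw [Nat.add_sub_cancel_left, pow_add, mul_right_comm, ← mul_pow]
      simp
    rw [hs]
    ring
  rw [e2, intervalIntegral.integral_finsetSum]
  · simp only [intervalIntegral.integral_const_mul, integral_pow_mul_log]
    rw [show (2 : ℝ) ^ (2 * κ + 1) = 2 * 4 ^ κ by rw [pow_succ, pow_mul]; norm_num; ring,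
      Finset.mul_sum, Finset.mul_sum, ← Finset.sum_neg_distrib]
    refine Finset.sum_congr rfl fun ν hν => ?_
    have hν' : ν ≤ κ := by simpa [Nat.lt_succ_iff] using hν
    rw [Nat.cast_sub (by omega)]
    push_cast
    ring
  · intro ν _
    exact (intervalIntegrable_mul_log _ (continuous_pow _) _ _).const_mul _

/-! ### The closed form -/

/-- The coefficients `ν * g_ν` of the derivative of the closed form, with value `1 / (2κ + 1)`
at `ν = 0`. -/
def derivCoeff (κ ν : ℕ) : ℝ :=
  2 ^ ν * (κ.choose ν : ℝ) * (ν ! * (2 * κ - ν)!) / (2 * κ + 1)!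

lemma derivCoeff_zero (κ : ℕ) : derivCoeff κ 0 = 1 / (2 * κ + 1) := by
  have : ((2 * κ)! : ℝ) ≠ 0 := by positivity
  rw [derivCoeff, Nat.factorial_succ]
  push_cast
  simp
  field_simp

/-- This recursion is what makes the sum in `sum_derivCoeff` telescope. -/
lemma derivCoeff_succ {κ ν : ℕ} (h : ν < κ) :
    derivCoeff κ (ν + 1) * (2 * κ - ν) = 2 * (κ - ν) * derivCoeff κ ν := by
  have h1 := Nat.choose_succ_right_eq κ ν
  have h1' : (κ.choose (ν + 1) : ℝ) * (ν + 1) = κ.choose ν * (κ - ν) := by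
    rw [← Nat.cast_sub h.le]
    exact_mod_cast h1
  obtain ⟨m, hm⟩ : ∃ m, 2 * κ = ν + 1 + m := Nat.exists_eq_add_of_le (by omega)
  have hm' : 2 * (κ : ℝ) - ν = m + 1 := by
    have : 2 * (κ : ℝ) = ν + 1 + m := by exact_mod_cast hm
    linear_combination this
  rw [derivCoeff, derivCoeff, hm', show 2 * κ - ν = m + 1 by omega,
    show 2 * κ - (ν + 1) = m by omega, Nat.factorial_succ ν, Nat.factorial_succ m]
  push_cast
  have : ((2 * κ + 1)! : ℝ) ≠ 0 := by positivity
  field_simp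
  linear_combination (2 * (2 : ℝ) ^ ν) * h1'

lemma natCast_mul_gCoeff {κ ν : ℕ} (h1 : 1 ≤ ν) (h : ν ≤ κ) :
    (ν : ℝ) * gCoeff κ ν = derivCoeff κ ν := by
  rcases eq_or_ne ν 1 with rfl | hν
  · have h2 := derivCoeff_succ (κ := κ) (ν := 0) (by omega)
    rw [derivCoeff_zero] at h2
    have hκ : (κ : ℝ) ≠ 0 := by
      have : κ ≠ 0 := by omega
      exact_mod_cast this
    have : derivCoeff κ 1 = 1 / (2 * κ + 1) := by
      apply mul_left_cancel₀ (mul_ne_zero two_ne_zero hκ)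
      push_cast at h2
      linear_combination h2
    simp [gCoeff, this]
  · obtain ⟨ν, rfl⟩ : ∃ m, ν = m + 1 := ⟨ν - 1, by omega⟩
    rw [gCoeff, if_neg (by omega), if_neg hν, derivCoeff, Nat.add_sub_cancel,
      Nat.factorial_succ ν]
    push_cast
    ring

/-- The primitive of `(1 - x ^ 2) ^ κ` that vanishes at `-1`. -/
def weightPrim (κ : ℕ) (x : ℝ) : ℝ :=
  (1 + x) ^ (κ + 1) * ∑ ν ∈ Finset.range (κ + 1), derivCoeff κ ν * (1 - x) ^ (κ - ν)

/-- With u = 1 - x, this is the derivative of `weightPrim κ` after the factor (1 + x)^κ is removed.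
The terms with ν < κ are b ν - b (ν + 1) and the last is b κ, leaving b 0 = u^κ. -/
lemma sum_derivCoeff (κ : ℕ) (u : ℝ) :
    ∑ ν ∈ Finset.range (κ + 1), ((κ + 1) * (derivCoeff κ ν * u ^ (κ - ν)) -
      (2 - u) * (derivCoeff κ ν * ((κ - ν : ℕ) * u ^ (κ - ν - 1)))) = u ^ κ := by
  set b : ℕ → ℝ := fun ν => derivCoeff κ ν * (2 * κ + 1 - ν) * u ^ (κ - ν) with hb
  have h : ∀ ν ∈ Finset.range κ, ((κ + 1) * (derivCoeff κ ν * u ^ (κ - ν)) -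
      (2 - u) * (derivCoeff κ ν * ((κ - ν : ℕ) * u ^ (κ - ν - 1)))) = b ν - b (ν + 1) := by
    intro ν hν
    have hν' : ν < κ := Finset.mem_range.1 hν
    have e : κ - ν = κ - (ν + 1) + 1 := by omega
    have hc := derivCoeff_succ hν'
    simp only [hb]
    rw [Nat.cast_sub hν'.le, show κ - ν - 1 = κ - (ν + 1) by omega,
      show u ^ (κ - ν) = u ^ (κ - (ν + 1)) * u by rw [e, pow_succ]]
    push_cast
    linear_combination u ^ (κ - (ν + 1)) * hc
  rw [Finset.sum_range_succ, Finset.sum_congr rfl h, Finset.sum_range_sub']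
  have : 2 * (κ : ℝ) + 1 ≠ 0 := by positivity
  simp [hb, derivCoeff_zero]
  field_simp
  ring

lemma hasDerivAt_weightPrim (κ : ℕ) (x : ℝ) :
    HasDerivAt (weightPrim κ) ((1 - x ^ 2) ^ κ) x := by
  have h1 := ((hasDerivAt_id x).const_add 1).fun_pow (κ + 1)
  have h2 : HasDerivAt
      (fun x : ℝ => ∑ ν ∈ Finset.range (κ + 1), derivCoeff κ ν * (1 - x) ^ (κ - ν))
      (∑ ν ∈ Finset.range (κ + 1),
        derivCoeff κ ν * (((κ - ν : ℕ) : ℝ) * (1 - x) ^ (κ - ν - 1) * (-1))) x :=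
    HasDerivAt.fun_sum fun ν _ =>
      (((hasDerivAt_id x).const_sub 1).fun_pow (κ - ν)).const_mul (derivCoeff κ ν)
  refine (h1.mul h2).congr_deriv ?_
  have h3 := sum_derivCoeff κ (1 - x)
  rw [Finset.sum_sub_distrib, ← Finset.mul_sum, ← Finset.mul_sum] at h3
  have h4 : ∑ ν ∈ Finset.range (κ + 1),
        derivCoeff κ ν * (((κ - ν : ℕ) : ℝ) * (1 - x) ^ (κ - ν - 1) * (-1)) =
      -∑ ν ∈ Finset.range (κ + 1),
        derivCoeff κ ν * (((κ - ν : ℕ) : ℝ) * (1 - x) ^ (κ - ν - 1)) := by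
    rw [← Finset.sum_neg_distrib]
    exact Finset.sum_congr rfl fun _ _ => by ring
  rw [h4, show 1 - x ^ 2 = (1 + x) * (1 - x) by ring, mul_pow, ← h3]
  simp
  ring

lemma sum_range_succ_eq_add_sum_Icc (κ : ℕ) (f : ℕ → ℝ) :
    ∑ ν ∈ Finset.range (κ + 1), f ν = f 0 + ∑ ν ∈ Finset.Icc 1 κ, f ν := by
  have : Finset.Icc 1 κ = Finset.Ico 1 (κ + 1) := by ext; simp
  rw [this, Finset.range_eq_Ico, Finset.sum_eq_sum_Ico_succ_bot (by omega)]

lemma hasDerivAt_SFun (κ : ℕ) {x : ℝ} (hx : x ≠ 1) :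
    HasDerivAt (SFun κ)
      (∑ ν ∈ Finset.range (κ + 1), derivCoeff κ ν * ((1 - x) ^ (ν + 1))⁻¹) x := by
  have hx' : 1 - x ≠ 0 := sub_ne_zero.2 hx.symm
  have h1 : HasDerivAt (fun x : ℝ => -1 / (2 * (κ : ℝ) + 1) * Real.log ((1 - x) / 2))
      (derivCoeff κ 0 * ((1 - x) ^ (0 + 1))⁻¹) x := by
    have := ((((hasDerivAt_id x).const_sub 1).div_const 2).log
      (by simpa using hx')).const_mul (-1 / (2 * (κ : ℝ) + 1))
    refine this.congr_deriv ?_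
    rw [derivCoeff_zero]
    simp
    field_simp
  have h2 : HasDerivAt (fun x : ℝ => ∑ ν ∈ Finset.Icc 1 κ, gCoeff κ ν * ((1 - x) ^ ν)⁻¹)
      (∑ ν ∈ Finset.Icc 1 κ, derivCoeff κ ν * ((1 - x) ^ (ν + 1))⁻¹) x := by
    refine HasDerivAt.fun_sum fun ν hν => ?_
    obtain ⟨hν1, hν2⟩ := Finset.mem_Icc.1 hν
    have := ((((hasDerivAt_id x).const_sub 1).fun_pow ν).fun_inv
      (pow_ne_zero _ (by simpa using hx'))).const_mul (gCoeff κ ν)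
    refine this.congr_deriv ?_
    rw [← natCast_mul_gCoeff hν1 hν2]
    obtain ⟨m, rfl⟩ : ∃ m, ν = m + 1 := ⟨ν - 1, by omega⟩
    simp
    field_simp
    ring
  rw [sum_range_succ_eq_add_sum_Icc]
  exact h1.add h2

/-- The property that singles out the coefficients g_ν: the flux (1 - x²)^(κ+1) S' is a primitive of
the weight. -/
lemma weight_mul_deriv_SFun (κ : ℕ) {x : ℝ} (hx : x ≠ 1) :
    (1 - x ^ 2) ^ (κ + 1) *
      ∑ ν ∈ Finset.range (κ + 1), derivCoeff κ ν * ((1 - x) ^ (ν + 1))⁻¹ = weightPrim κ x := by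
  rw [weightPrim, Finset.mul_sum, Finset.mul_sum]
  refine Finset.sum_congr rfl fun ν hν => ?_
  have hν' : ν ≤ κ := by simpa [Nat.lt_succ_iff] using hν
  rw [mul_left_comm, one_sub_sq_pow_mul_inv (by omega) hx,
    show κ + 1 - (ν + 1) = κ - ν by omega]
  ring

/-- One power of 1 - x² beyond the weight absorbs the logarithm and the poles of order at most κ, so
the boundary term of the integration by parts vanishes at 1. -/
lemma continuous_SFun_mul_weight (κ : ℕ) :
    Continuous (fun x => SFun κ x * (1 - x ^ 2) ^ (κ + 1)) := by
  have e : (fun x => SFun κ x * (1 - x ^ 2) ^ (κ + 1)) = fun x =>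
      -1 / (2 * (κ : ℝ) + 1) * ((1 - x) / 2 * Real.log ((1 - x) / 2)) *
        (2 * (1 + x) ^ (κ + 1) * (1 - x) ^ κ) +
      ∑ ν ∈ Finset.Icc 1 κ, gCoeff κ ν * ((1 + x) ^ (κ + 1) * (1 - x) ^ (κ + 1 - ν)) := by
    ext x
    rw [SFun, add_mul, Finset.sum_mul]
    congr 1
    · rw [show 1 - x ^ 2 = (1 + x) * (1 - x) by ring, mul_pow]
      ring
    · refine Finset.sum_congr rfl fun ν hν => ?_
      obtain ⟨hν1, hν2⟩ := Finset.mem_Icc.1 hν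
      rcases eq_or_ne x 1 with rfl | hx
      · rw [sub_self, zero_pow (by omega : κ + 1 - ν ≠ 0)]
        simp
      · rw [mul_assoc, mul_comm _ ((1 - x ^ 2) ^ (κ + 1)),
          one_sub_sq_pow_mul_inv (by omega) hx]
  rw [e]
  have hl : Continuous (fun x : ℝ => (1 - x) / 2 * Real.log ((1 - x) / 2)) :=
    Real.continuous_mul_log.comp (by fun_prop : Continuous fun x : ℝ => (1 - x) / 2)
  fun_prop

lemma intervalIntegrable_log_weight (κ : ℕ) :
    IntervalIntegrable (fun x => Real.log ((1 - x) / 2) * (1 - x ^ 2) ^ κ) volume (-1) 1 := by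
  have h : IntervalIntegrable (fun x : ℝ => Real.log (1 - x)) volume (-1) 1 := by
    have := (intervalIntegral.intervalIntegrable_log' (a := 2) (b := 0)).comp_sub_left 1
    norm_num at this
    exact this
  have h2 : IntervalIntegrable (fun x : ℝ => (Real.log (1 - x) - Real.log 2) * (1 - x ^ 2) ^ κ)
      volume (-1) 1 :=
    (h.sub intervalIntegrable_const).mul_continuousOn (by fun_prop)
  refine h2.congr_ae ?_
  refine ae_restrict_of_ae ?_
  filter_upwards [ae_ne_one] with x hx
  rw [Real.log_div (sub_ne_zero.2 hx.symm) two_ne_zero]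

lemma SFun_mul_weight {κ : ℕ} {x : ℝ} (hx : x ≠ 1) :
    SFun κ x * (1 - x ^ 2) ^ κ =
      -1 / (2 * κ + 1) * (Real.log ((1 - x) / 2) * (1 - x ^ 2) ^ κ) +
      ∑ ν ∈ Finset.Icc 1 κ, gCoeff κ ν * ((1 + x) ^ κ * (1 - x) ^ (κ - ν)) := by
  rw [SFun, add_mul, Finset.sum_mul, mul_assoc]
  congr 1
  refine Finset.sum_congr rfl fun ν hν => ?_
  rw [mul_assoc, mul_comm _ ((1 - x ^ 2) ^ κ),
    one_sub_sq_pow_mul_inv (Finset.mem_Icc.1 hν).2 hx]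

lemma intervalIntegrable_SFun_mul_weight (κ : ℕ) :
    IntervalIntegrable (fun x => SFun κ x * (1 - x ^ 2) ^ κ) volume (-1) 1 := by
  have h : IntervalIntegrable (fun x =>
      -1 / (2 * (κ : ℝ) + 1) * (Real.log ((1 - x) / 2) * (1 - x ^ 2) ^ κ) +
      ∑ ν ∈ Finset.Icc 1 κ, gCoeff κ ν * ((1 + x) ^ κ * (1 - x) ^ (κ - ν))) volume (-1) 1 :=
    ((intervalIntegrable_log_weight κ).const_mul _).add
      (Continuous.intervalIntegrable (by fun_prop) _ _)
  refine h.congr_ae (ae_restrict_of_ae ?_)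
  filter_upwards [ae_ne_one] with x hx using (SFun_mul_weight hx).symm

lemma integral_SFun_mul_weight (κ : ℕ) :
    ∫ x in (-1 : ℝ)..1, SFun κ x * (1 - x ^ 2) ^ κ = weightInt κ 1 * DConst κ := by
  have e : ∫ x in (-1 : ℝ)..1, SFun κ x * (1 - x ^ 2) ^ κ = ∫ x in (-1 : ℝ)..1,
      (-1 / (2 * (κ : ℝ) + 1) * (Real.log ((1 - x) / 2) * (1 - x ^ 2) ^ κ) +
      ∑ ν ∈ Finset.Icc 1 κ, gCoeff κ ν * ((1 + x) ^ κ * (1 - x) ^ (κ - ν))) := by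
    refine intervalIntegral.integral_congr_ae ?_
    filter_upwards [ae_ne_one] with x hx _ using SFun_mul_weight hx
  have hsum : ∑ ν ∈ Finset.Icc 1 κ,
        ∫ x in (-1 : ℝ)..1, gCoeff κ ν * ((1 + x) ^ κ * (1 - x) ^ (κ - ν)) =
      ∑ ν ∈ Finset.Icc 1 κ, gCoeff κ ν * GConst κ ν := by
    refine Finset.sum_congr rfl fun ν hν => ?_
    have hν' := (Finset.mem_Icc.1 hν).2
    rw [intervalIntegral.integral_const_mul, integral_one_add_pow_mul_one_sub_pow, GConst,
      show κ + (κ - ν) = 2 * κ - ν by omega]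
  have hpos := (weightInt_one_pos κ).ne'
  rw [e, intervalIntegral.integral_add ((intervalIntegrable_log_weight κ).const_mul _)
      (Continuous.intervalIntegrable (by fun_prop) _ _), intervalIntegral.integral_const_mul,
    integral_log_mul_weight, intervalIntegral.integral_finsetSum
      (fun ν _ => Continuous.intervalIntegrable (by fun_prop) _ _), hsum,
    DConst, betaConst_eq, ← weightInt_one]
  field_simp
  ring

lemma integral_SFun_mul_gegPoly {κ n : ℕ} (hn : n ≠ 0) :
    ∫ x in (-1 : ℝ)..1, SFun κ x * (gegPoly κ n).eval x * (1 - x ^ 2) ^ κ =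
      weightInt κ 1 / (n * (n + 2 * κ + 1)) := by
  have hprim : weightPrim κ 1 = weightInt κ 1 := by
    have h := intervalIntegral.integral_eq_sub_of_hasDerivAt (a := -1) (b := 1)
      (fun x _ => hasDerivAt_weightPrim κ x) (Continuous.intervalIntegrable (by fun_prop) _ _)
    rw [weightInt_apply]
    simp only [eval_one, one_mul]
    rw [h]
    simp [weightPrim]
  have hcF : Continuous (weightPrim κ) :=
    continuous_iff_continuousAt.2 fun x => (hasDerivAt_weightPrim κ x).continuousAt
  have hS := continuous_SFun_mul_weight κ
  -- Green's identity: on differentiating F W_n - S (1 - x²)^(κ+1) W_n', the two terms containing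
  -- W_n' cancel because F = (1 - x²)^(κ+1) S'. This function equals F(1) at 1 and 0 at -1.
  have hc : Continuous (fun x => weightPrim κ x * (gegPoly κ n).eval x -
      SFun κ x * (1 - x ^ 2) ^ (κ + 1) * (derivative (gegPoly κ n)).eval x) := by fun_prop
  have hd : ∀ x ∈ Ioo (-1 : ℝ) 1, HasDerivAt (fun x => weightPrim κ x * (gegPoly κ n).eval x -
      SFun κ x * (1 - x ^ 2) ^ (κ + 1) * (derivative (gegPoly κ n)).eval x)
      ((gegPoly κ n).eval x * (1 - x ^ 2) ^ κ +
        (n * (n + 2 * κ + 1)) * (SFun κ x * (1 - x ^ 2) ^ κ * (gegPoly κ n).eval x)) x := by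
    intro x hx
    have hx1 := hx.2.ne
    have e : (fun x => weightPrim κ x * (gegPoly κ n).eval x -
      SFun κ x * (1 - x ^ 2) ^ (κ + 1) * (derivative (gegPoly κ n)).eval x) =
      fun x => weightPrim κ x * (gegPoly κ n).eval x -
      SFun κ x * ((1 - x ^ 2) ^ (κ + 1) * (derivative (gegPoly κ n)).eval x) := by
      ext x; ring
    rw [e]
    refine (((hasDerivAt_weightPrim κ x).mul ((gegPoly κ n).hasDerivAt x)).sub
      ((hasDerivAt_SFun κ hx1).mul (hasDerivAt_weight_mul_derivative κ n x))).congr_deriv ?_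
    rw [← weight_mul_deriv_SFun κ hx1]
    ring
  have hI1 : IntervalIntegrable (fun x => (gegPoly κ n).eval x * (1 - x ^ 2) ^ κ)
      volume (-1) 1 := Continuous.intervalIntegrable (by fun_prop) _ _
  have hI2 : IntervalIntegrable (fun x => (n * (n + 2 * κ + 1) : ℝ) *
      (SFun κ x * (1 - x ^ 2) ^ κ * (gegPoly κ n).eval x)) volume (-1) 1 :=
    ((intervalIntegrable_SFun_mul_weight κ).mul_continuousOn
      (gegPoly κ n).continuous.continuousOn).const_mul _
  have h := intervalIntegral.integral_eq_sub_of_hasDerivAt_of_le (by norm_num) hc.continuousOn hd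
    (hI1.add hI2)
  rw [intervalIntegral.integral_add hI1 hI2, ← weightInt_apply, weightInt_gegPoly hn,
    intervalIntegral.integral_const_mul, hprim, gegPoly_eval_one] at h
  norm_num [weightPrim] at h
  have hn' : (0 : ℝ) < n := by exact_mod_cast Nat.pos_of_ne_zero hn
  rw [eq_div_iff (by positivity), ← h, mul_comm]
  congr 1
  exact intervalIntegral.integral_congr fun x _ => by ring

/-! ### Uniqueness of expansions -/

/-- It suffices to test against smooth θ. Replacing θ by θ - p, with p a polynomial uniformly
ε-close to θ on [a, b], does not change the integral and bounds it by ε ∫ |g|. -/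
lemma ae_eq_zero_of_integral_mul_polynomial {a b : ℝ} (hab : a ≤ b) {g : ℝ → ℝ}
    (hg : IntegrableOn g (Icc a b))
    (h : ∀ p : ℝ[X], ∫ x in a..b, g x * p.eval x = 0) :
    g =ᵐ[volume.restrict (Icc a b)] 0 := by
  have hgi : IntervalIntegrable g volume a b :=
    (intervalIntegrable_iff_integrableOn_Icc_of_le hab).2 hg
  refine ae_eq_zero_of_integral_contDiff_smul_eq_zero hg.locallyIntegrable ?_
  intro θ hθ _
  rw [integral_Icc_eq_integral_Ioc, ← intervalIntegral.integral_of_le hab]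
  simp only [smul_eq_mul]
  set I := ∫ x in a..b, θ x * g x with hI
  set N := ∫ x in a..b, |g x| with hN
  have hN0 : 0 ≤ N := intervalIntegral.integral_nonneg hab fun _ _ => abs_nonneg _
  have key : ∀ ε > 0, |I| ≤ ε * N := by
    intro ε hε
    obtain ⟨p, hp⟩ := exists_polynomial_near_of_continuousOn a b θ hθ.continuous.continuousOn ε hε
    have h1 : I = ∫ x in a..b, (θ x - p.eval x) * g x := by
      have : ∀ x, (θ x - p.eval x) * g x = θ x * g x - g x * p.eval x := fun x => by ring
      simp only [this]
      rw [intervalIntegral.integral_sub (hgi.continuousOn_mul hθ.continuous.continuousOn)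
        (hgi.mul_continuousOn p.continuous.continuousOn), h, sub_zero]
    rw [h1, hN, ← intervalIntegral.integral_const_mul, ← Real.norm_eq_abs]
    refine intervalIntegral.norm_integral_le_of_norm_le hab ?_ (hgi.abs.const_mul ε)
    filter_upwards with x hx
    rw [Real.norm_eq_abs, abs_mul]
    have := hp x (Ioc_subset_Icc_self hx)
    rw [abs_sub_comm] at this
    exact mul_le_mul_of_nonneg_right this.le (abs_nonneg _)
  by_contra hne
  have hpos : 0 < |I| := abs_pos.2 hne
  -- The choice of ε forces 2(N + 1)|I| ≤ |I| N; using N + 1 keeps the denominator positive when N =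
  -- 0.
  have h2 := key (|I| / (2 * (N + 1))) (by positivity)
  rw [div_mul_eq_mul_div, le_div_iff₀ (by positivity)] at h2
  nlinarith

lemma ae_eq_of_gegPoly_coeff_eq {κ : ℕ} {f g : ℝ → ℝ}
    (hf : IntegrableOn (fun x => f x * (1 - x ^ 2) ^ κ) (Icc (-1) 1))
    (hg : IntegrableOn (fun x => g x * (1 - x ^ 2) ^ κ) (Icc (-1) 1))
    (h : ∀ n, ∫ x in (-1 : ℝ)..1, f x * (gegPoly κ n).eval x * (1 - x ^ 2) ^ κ =
      ∫ x in (-1 : ℝ)..1, g x * (gegPoly κ n).eval x * (1 - x ^ 2) ^ κ) :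
    f =ᵐ[volume.restrict (Icc (-1) 1)] g := by
  have hle : (-1 : ℝ) ≤ 1 := by norm_num
  have hfg : IntegrableOn (fun x => (f x - g x) * (1 - x ^ 2) ^ κ) (Icc (-1) 1) := by
    simp only [sub_mul]
    exact hf.sub hg
  have hI (p : ℝ[X]) : IntervalIntegrable (fun x => (f x - g x) * (1 - x ^ 2) ^ κ * p.eval x)
      volume (-1) 1 :=
    ((intervalIntegrable_iff_integrableOn_Icc_of_le hle).2 hfg).mul_continuousOn
      p.continuous.continuousOn
  have hmom (p : ℝ[X]) : ∫ x in (-1 : ℝ)..1, (f x - g x) * (1 - x ^ 2) ^ κ * p.eval x = 0 := by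
    have hp : p ∈ Submodule.span ℝ (range (gegPoly κ)) := by rw [span_gegPoly]; trivial
    induction hp using Submodule.span_induction with
    | mem p hp =>
      obtain ⟨n, rfl⟩ := hp
      have e : ∀ x, (f x - g x) * (1 - x ^ 2) ^ κ * (gegPoly κ n).eval x =
          f x * (gegPoly κ n).eval x * (1 - x ^ 2) ^ κ -
          g x * (gegPoly κ n).eval x * (1 - x ^ 2) ^ κ := fun x => by ring
      have hi {u : ℝ → ℝ} (hu : IntegrableOn (fun x => u x * (1 - x ^ 2) ^ κ) (Icc (-1) 1)) :
          IntervalIntegrable (fun x => u x * (gegPoly κ n).eval x * (1 - x ^ 2) ^ κ)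
            volume (-1) 1 := by
        simp only [mul_right_comm _ (eval _ (gegPoly κ n))]
        exact ((intervalIntegrable_iff_integrableOn_Icc_of_le hle).2 hu).mul_continuousOn
          (gegPoly κ n).continuous.continuousOn
      simp only [e]
      rw [intervalIntegral.integral_sub (hi hf) (hi hg), h, sub_self]
    | zero => simp
    | add p q _ _ hp hq =>
      simp only [eval_add, mul_add]
      rw [intervalIntegral.integral_add (hI p) (hI q), hp, hq, add_zero]
    | smul a p _ hp =>
      simp only [eval_smul, smul_eq_mul, mul_left_comm _ a]
      rw [intervalIntegral.integral_const_mul, hp, mul_zero]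
  have h0 := ae_eq_zero_of_integral_mul_polynomial hle hfg hmom
  have hm1 : ∀ᵐ x : ℝ, x ≠ -1 := by simp [ae_iff]
  -- The argument so far gives (f - g) w = 0 almost everywhere; w can vanish only at ±1, a null set.
  filter_upwards [h0, ae_restrict_of_ae ae_ne_one, ae_restrict_of_ae hm1] with x hx h1 h2
  have hw : (1 - x ^ 2) ^ κ ≠ 0 := by
    rw [show 1 - x ^ 2 = (1 - x) * (x - -1) by ring]
    exact pow_ne_zero _ (mul_ne_zero (sub_ne_zero.2 h1.symm) (sub_ne_zero.2 h2))
  exact sub_eq_zero.1 ((mul_eq_zero.1 hx).resolve_right hw)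

/-! ### The thinplate series -/

lemma gegInner_eq {lam : ℝ} {κ : ℕ} (hl : lam = κ + 1 / 2) (f g : ℝ → ℝ) :
    gegInner lam f g = ∫ x in (-1 : ℝ)..1, f x * g x * (1 - x ^ 2) ^ κ := by
  have : lam - 1 / 2 = κ := by rw [hl]; ring
  simp only [gegInner, this, Real.rpow_natCast]

/-- Multiplying each coefficient by ‖W_n‖² ≠ 0 cancels N_{d,n} by `weightInt_sq_mul_harmonicDim`,
and the real power in the weight becomes a natural one. -/
lemma hasThinplateSeries_iff (κ : ℕ) (f : ℝ → ℝ) :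
    HasThinplateSeries (2 * κ + 3) 1 f ↔
      IntegrableOn (fun x => f x * (1 - x ^ 2) ^ κ) (Icc (-1) 1) ∧
      ∀ n : ℕ, ∫ x in (-1 : ℝ)..1, f x * (gegPoly κ n).eval x * (1 - x ^ 2) ^ κ =
        if n = 0 then 0 else weightInt κ 1 / (n * (n + 2 * κ + 1)) := by
  have hl : (((2 * κ + 3 : ℕ) : ℝ) - 2) / 2 = κ + 1 / 2 := by push_cast; ring
  have hl' : (((2 * κ + 3 : ℕ) : ℝ) - 2) / 2 - 1 / 2 = κ := by rw [hl]; ring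
  have hcoeff (n : ℕ) :
      gegInner ((((2 * κ + 3 : ℕ) : ℝ) - 2) / 2) f
          (gegenbauerW ((((2 * κ + 3 : ℕ) : ℝ) - 2) / 2) n) /
        gegInner ((((2 * κ + 3 : ℕ) : ℝ) - 2) / 2)
          (gegenbauerW ((((2 * κ + 3 : ℕ) : ℝ) - 2) / 2) n)
          (gegenbauerW ((((2 * κ + 3 : ℕ) : ℝ) - 2) / 2) n) =
        (if n = 0 then 0 else
          (((n : ℝ) * ((n : ℝ) + ((2 * κ + 3 : ℕ) : ℝ) - 2)) ^ 1)⁻¹ *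
            harmonicDim (2 * κ + 3) n) ↔
      ∫ x in (-1 : ℝ)..1, f x * (gegPoly κ n).eval x * (1 - x ^ 2) ^ κ =
        if n = 0 then 0 else weightInt κ 1 / (n * (n + 2 * κ + 1)) := by
    have hh := weightInt_sq_mul_harmonicDim κ n
    have hne : weightInt κ (gegPoly κ n * gegPoly κ n) ≠ 0 := by
      intro h0
      rw [h0, zero_mul] at hh
      exact (weightInt_one_pos κ).ne hh
    have e2 : gegInner ((((2 * κ + 3 : ℕ) : ℝ) - 2) / 2)
          (gegenbauerW ((((2 * κ + 3 : ℕ) : ℝ) - 2) / 2) n)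
          (gegenbauerW ((((2 * κ + 3 : ℕ) : ℝ) - 2) / 2) n) =
        weightInt κ (gegPoly κ n * gegPoly κ n) := by
      simp only [gegInner_eq hl, gegenbauerW_eq hl, weightInt_apply, eval_mul]
    rw [e2, gegInner_eq hl, div_eq_iff hne]
    simp only [gegenbauerW_eq hl]
    split_ifs with hn
    · rw [zero_mul]
    · rw [mul_assoc, mul_comm (harmonicDim _ _), hh, pow_one, inv_mul_eq_div]
      push_cast
      rw [show (n : ℝ) + (2 * κ + 3) - 2 = n + 2 * κ + 1 by ring]
  constructor
  · intro h
    refine ⟨?_, fun n => (hcoeff n).1 (h.coeff_eq n)⟩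
    have := h.integrable
    simpa only [hl', Real.rpow_natCast] using this
  · rintro ⟨h1, h2⟩
    refine ⟨?_, fun n => (hcoeff n).2 (h2 n)⟩
    simpa only [hl', Real.rpow_natCast] using h1

lemma hasThinplateSeries_SFun (κ : ℕ) :
    HasThinplateSeries (2 * κ + 3) 1 (fun x => SFun κ x - DConst κ) := by
  have hle : (-1 : ℝ) ≤ 1 := by norm_num
  rw [hasThinplateSeries_iff]
  have hS := intervalIntegrable_SFun_mul_weight κ
  constructor
  · rw [← intervalIntegrable_iff_integrableOn_Icc_of_le hle]
    simp only [sub_mul]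
    exact hS.sub (Continuous.intervalIntegrable (by fun_prop) _ _)
  · intro n
    have e : ∀ x, (SFun κ x - DConst κ) * (gegPoly κ n).eval x * (1 - x ^ 2) ^ κ =
        SFun κ x * (gegPoly κ n).eval x * (1 - x ^ 2) ^ κ -
          DConst κ * ((gegPoly κ n).eval x * (1 - x ^ 2) ^ κ) := fun x => by ring
    have hI : IntervalIntegrable (fun x => SFun κ x * (gegPoly κ n).eval x * (1 - x ^ 2) ^ κ)
        volume (-1) 1 := by
      simp only [mul_right_comm _ (eval _ (gegPoly κ n))]
      exact hS.mul_continuousOn (gegPoly κ n).continuous.continuousOn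
    simp only [e]
    rw [intervalIntegral.integral_sub hI (Continuous.intervalIntegrable (by fun_prop) _ _),
      intervalIntegral.integral_const_mul, ← weightInt_apply]
    split_ifs with hn
    · subst hn
      simp only [gegPoly_zero, eval_one, mul_one]
      rw [integral_SFun_mul_weight]
      ring
    · rw [integral_SFun_mul_gegPoly hn, weightInt_gegPoly hn, mul_zero, sub_zero]

lemma hasThinplateSeries_iff_ae_eq (κ : ℕ) (f : ℝ → ℝ) :
    HasThinplateSeries (2 * κ + 3) 1 f ↔
      f =ᵐ[volume.restrict (Icc (-1) 1)] fun x => SFun κ x - DConst κ := by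
  have hK := (hasThinplateSeries_iff κ _).1 (hasThinplateSeries_SFun κ)
  rw [hasThinplateSeries_iff]
  constructor
  · rintro ⟨h1, h2⟩
    exact ae_eq_of_gegPoly_coeff_eq h1 hK.1 fun n => (h2 n).trans (hK.2 n).symm
  · intro h
    refine ⟨hK.1.congr_fun_ae ?_, fun n => (Eq.trans ?_ (hK.2 n))⟩
    · filter_upwards [h] with x hx
      rw [hx]
    · refine intervalIntegral.integral_congr_ae ?_
      have h' := (ae_restrict_iff' measurableSet_Icc).1 h
      filter_upwards [h'] with x hx hx'
      rw [uIoc_of_le (by norm_num)] at hx'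
      rw [hx (Ioc_subset_Icc_self hx')]

lemma continuousOn_SFun (κ : ℕ) : ContinuousOn (SFun κ) (Ico (-1) 1) := fun _ hx =>
  (hasDerivAt_SFun κ hx.2.ne).continuousAt.continuousWithinAt

lemma DConst_eq (κ : ℕ) :
    DConst κ = gegInner (κ + 1 / 2) (SFun κ) (fun _ => 1) /
      gegInner (κ + 1 / 2) (fun _ => 1) (fun _ => 1) := by
  have hpos := (weightInt_one_pos κ).ne'
  have h1 : gegInner (κ + 1 / 2) (fun _ => 1) (fun _ => 1) = weightInt κ 1 := by
    rw [gegInner_eq rfl]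
    simp [weightInt_apply]
  rw [h1, gegInner_eq rfl]
  simp only [mul_one]
  rw [integral_SFun_mul_weight, mul_div_cancel_left₀ _ hpos]

end

end Thinplate

theorem mainTheorem4 (κ : ℕ) :
    (∀ f : ℝ → ℝ, Thinplate.HasThinplateSeries (2 * κ + 3) 1 f ↔
      f =ᵐ[volume.restrict (Icc (-1) 1)] fun x =>
        -1 / (2 * κ + 1) * Real.log ((1 - x) / 2) +
          ∑ ν ∈ Finset.Icc 1 κ, Thinplate.gCoeff κ ν * ((1 - x) ^ ν)⁻¹ - Thinplate.DConst κ) ∧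
    (∀ f : ℝ → ℝ, Thinplate.HasThinplateSeries (2 * κ + 3) 1 f → ContinuousOn f (Ico (-1) 1) →
      ∀ x ∈ Ico (-1 : ℝ) 1, f x =
        -1 / (2 * κ + 1) * Real.log ((1 - x) / 2) +
          ∑ ν ∈ Finset.Icc 1 κ, Thinplate.gCoeff κ ν * ((1 - x) ^ ν)⁻¹ - Thinplate.DConst κ) ∧
    (∀ ν ≤ κ, ∫ x in (-1 : ℝ)..1, (1 - x ^ 2) ^ κ * ((1 - x) ^ ν)⁻¹ = Thinplate.GConst κ ν) ∧
    Thinplate.DConst κ =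
      Thinplate.gegInner (κ + 1 / 2) (Thinplate.SFun κ) (fun _ => 1) /
        Thinplate.gegInner (κ + 1 / 2) (fun _ => 1) (fun _ => 1) := by
  refine ⟨Thinplate.hasThinplateSeries_iff_ae_eq κ, fun f hf hc => ?_,
    fun ν hν => Thinplate.integral_eq_GConst hν, Thinplate.DConst_eq κ⟩
  have h := (Thinplate.hasThinplateSeries_iff_ae_eq κ f).1 hf
  -- Two functions continuous on [-1, 1) that agree almost everywhere there agree at every point.
  exact Measure.eqOn_Ico_of_ae_eq (μ := volume)
    (ae_restrict_of_ae_restrict_of_subset Ico_subset_Icc_self h) hc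
    ((Thinplate.continuousOn_SFun κ).sub continuousOn_const)
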